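/- **Theorem 4.2.** Let $G$ and $H$ be connected (real, finite-dimensional) Lie groups, and consider on $G$ and on $H$, with the same controls $u=(u_1,\dots,u_m)$, the affine control systems $$\frac{dg}{dt}=(\mathcal X_0+Z_0)(g)+\sum_{j=1}^m u_j(t)\,(\mathcal X_j+Z_j)(g),\qquad \frac{dh}{dt}=(\mathcal Y_0+W_0)(h)+\sum_{j=1}^m u_j(t)\,(\mathcal Y_j+W_j)(h),$$ where $Z_0,\dots,Z_m$ and $W_0,\dots,W_m$ are right invariant vector fields on $G$ and $H$, respectively, and $\mathcal X_0,\dots,\mathcal X_m$ and $\mathcal Y_0,\dots,\mathcal Y_m$ are linear vector fields on $G$ and $H$, i.e. smooth vector fields whose flows $\varphi^i_t$ (of $\mathcal X_i$) and $\psi^i_t$ (of $\mathcal Y_i$), $t\in\mathbb R$, consist of automorphisms of the Lie group. The admissible controls form a set $\mathcal U\subset L^\infty_{\mathrm{loc}}(\mathbb R;\mathbb R^m)$ that contains the constant controls $0$ and $e_1,\dots,e_m$ (the standard basis vectors). For $u\in\mathcal U$ let $\phi_t(g,u)$ and $\theta_t(h,u)$ denote the (Carathéodory) solutions of the two systems with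 $\phi_0(g,u)=g$ and $\theta_0(h,u)=h$. Let $F\colon G\to H$ be a homomorphism of Lie groups. Then the following conditions are equivalent: 1. $F(\phi_t(g,u))=\theta_t(F(g),u)$ for all $g\in G$, all $u\in\mathcal U$ and all $t$. (That is: on every interval $J\ni 0$ on which a solution $\phi_t(g,u)$ is given, the solution $\theta_t(F(g),u)$ exists and equals $F(\phi_t(g,u))$.) 2. $F\circ\varphi^i_t=\psi^i_t\circ F$ for all $i=0,1,\dots,m$ and all $t\in\mathbb R$, and $dF_e(Z_j(e))=W_j(e)$ for all $j=0,1,\dots,m$, where $e$ denotes the identity elements. -/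

import Mathlib

open scoped Manifold ContDiff

noncomputable section

namespace AffineControl

section Fields

variable {E : Type*} [NormedAddCommGroup E] [NormedSpace ℝ E]
  {M : Type*} [TopologicalSpace M] (I : ModelWithCorners ℝ E M)
  {G : Type*} [TopologicalSpace G] [ChartedSpace M G]

/-- A vector field on `G` is smooth if it is a smooth section of the tangent bundle. -/
def IsSmoothField [IsManifold I ∞ G] (X : ∀ g : G, TangentSpace I g) : Prop :=
  ContMDiff I I.tangent ∞ (fun g => (⟨g, X g⟩ : TangentBundle I G))

/-- `φ t g` (time `t`, starting point `g`) is the (complete) flow of the vector field `X`. -/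
def IsFlow (X : ∀ g : G, TangentSpace I g) (φ : ℝ → G → G) : Prop :=
  ∀ g : G, φ 0 g = g ∧ IsMIntegralCurve (I := I) (fun t => φ t g) X

/-- A linear vector field on a Lie group: a smooth vector field whose flow consists of
automorphisms of the Lie group (smooth group automorphisms; the inverse of the time `t` map of a
flow is the time `-t` map, so its smoothness need not be required separately). -/
structure IsLinearField [Group G] [LieGroup I ∞ G] (X : ∀ g : G, TangentSpace I g) : Prop where
  smooth : IsSmoothField I X
  exists_flow : ∃ φ : ℝ → (G ≃* G),
    (∀ t, ContMDiff I I ∞ (φ t)) ∧ IsFlow I X (fun t g => φ t g)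

/-- A right invariant vector field: a smooth vector field `Z` with
`d(R_g)_h Z(h) = Z(h g)` for all `g` and `h`. -/
structure IsRightInvariant [Group G] [LieGroup I ∞ G] (Z : ∀ g : G, TangentSpace I g) : Prop where
  smooth : IsSmoothField I Z
  map_mul_right : ∀ g h : G, mfderiv I I (fun x : G => x * g) h (Z h) = Z (h * g)

/-- The derivative at `x` of the real function `f` in the direction of the tangent vector `v`. -/
def dirDeriv (f : G → ℝ) (x : G) (v : TangentSpace I x) : ℝ :=
  mfderiv I 𝓘(ℝ, ℝ) f x v

end Fields

/-- The data of an affine control system with `m` controls on a Lie group `G`: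
`dg/dt = (X₀ + Z₀)(g) + ∑ j, u_j (X_j + Z_j)(g)`, `j = 1, …, m`, with linear vector fields
`X₀, …, X_m` and right invariant vector fields `Z₀, …, Z_m`. -/
structure AffineSystem {E : Type*} [NormedAddCommGroup E] [NormedSpace ℝ E]
    {M : Type*} [TopologicalSpace M] (I : ModelWithCorners ℝ E M)
    (G : Type*) [TopologicalSpace G] [ChartedSpace M G] [Group G]
    [LieGroup I ∞ G] (m : ℕ) where
  X : Fin (m + 1) → ∀ g : G, TangentSpace I g
  Z : Fin (m + 1) → ∀ g : G, TangentSpace I g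
  linear : ∀ i, IsLinearField I (X i)
  rightInvariant : ∀ i, IsRightInvariant I (Z i)

/-- Locally essentially bounded (measurable) controls `u : ℝ → ℝᵐ`. -/
def IsLInftyLoc {m : ℕ} (u : ℝ → Fin m → ℝ) : Prop :=
  ∀ K : Set ℝ, IsCompact K →
    MeasureTheory.MemLp u ⊤ (MeasureTheory.Measure.restrict MeasureTheory.volume K)

namespace AffineSystem

variable {E : Type*} [NormedAddCommGroup E] [NormedSpace ℝ E]
  {M : Type*} [TopologicalSpace M] {I : ModelWithCorners ℝ E M}
  {G : Type*} [TopologicalSpace G] [ChartedSpace M G] [Group G] [LieGroup I ∞ G]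
  {m : ℕ}

/-- The right hand side of the system at the control value `v ∈ ℝᵐ`. -/
def field (S : AffineSystem I G m) (v : Fin m → ℝ) (g : G) : TangentSpace I g :=
  (S.X 0 g + S.Z 0 g) + ∑ j : Fin m, v j • (S.X j.succ g + S.Z j.succ g)

/-- `γ` is, on the interval `J` containing `0`, a solution starting at `g` of the system for the
control `u`, in the sense of Carathéodory: `γ` is continuous and for every smooth function `f`
the function `f ∘ γ` is the indefinite integral of `t ↦ df_{γ(t)} (field (u t) (γ t))`. -/
structure IsSolution (S : AffineSystem I G m) (u : ℝ → Fin m → ℝ) (g : G) (J : Set ℝ)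
    (γ : ℝ → G) : Prop where
  initial : γ 0 = g
  continuousOn : ContinuousOn γ J
  integral_eq : ∀ f : G → ℝ, ContMDiff I 𝓘(ℝ, ℝ) ∞ f → ∀ t ∈ J,
    f (γ t) - f g = ∫ τ in (0 : ℝ)..t, dirDeriv I f (γ τ) (S.field (u τ) (γ τ))

end AffineSystem

/-- `F` conjugates the solutions of `S` to those of `S'`, `F(φ_t(g,u)) = θ_t(F(g),u)`, for all
controls `u` in `U`: on every interval `J` around `0` on which the solution `φ_t(g,u)` of `S` is
defined, the solution `θ_t(F(g),u)` of `S'` is defined too and is equal to `F(φ_t(g,u))`. -/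
def ConjugatesSolutions
    {E : Type*} [NormedAddCommGroup E] [NormedSpace ℝ E]
    {M : Type*} [TopologicalSpace M] {I : ModelWithCorners ℝ E M}
    {G : Type*} [TopologicalSpace G] [ChartedSpace M G] [Group G] [LieGroup I ∞ G]
    {E' : Type*} [NormedAddCommGroup E'] [NormedSpace ℝ E']
    {M' : Type*} [TopologicalSpace M'] {I' : ModelWithCorners ℝ E' M'}
    {H : Type*} [TopologicalSpace H] [ChartedSpace M' H] [Group H] [LieGroup I' ∞ H]
    {m : ℕ}
    (U : Set (ℝ → Fin m → ℝ)) (S : AffineSystem I G m) (S' : AffineSystem I' H m)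
    (F : G → H) : Prop :=
  ∀ u ∈ U, ∀ g : G, ∀ J : Set ℝ, J.OrdConnected → (0 : ℝ) ∈ J →
    ∀ φ : ℝ → G, S.IsSolution u g J φ →
      (∃ θ : ℝ → H, S'.IsSolution u (F g) J θ) ∧
      ∀ θ : ℝ → H, S'.IsSolution u (F g) J θ → ∀ t ∈ J, F (φ t) = θ t

end AffineControl

end

/-! Both conditions are equivalent to a third, infinitesimal one: for every `k` the field `X k + Z
k` is `F`-related to its counterpart on `H`. If the fields are related, the chain rule on test
functions makes `F ∘ γ` a solution for every solution `γ`. Uniqueness of Carathéodory solutions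
(`IsSolution.eqOn`) then identifies it with any other. Conversely, the constant controls `0` and
`e_j` have local integral curves as solutions; differentiating the conjugation at time `0` relates
the fields at these control values (`ConjugatesSolutions.fieldsRelated`), and subtraction isolates
each `k`. To separate the two summands, evaluate at the identity: linear fields vanish there, so
only `dF_e(Z_k(e)) = W_k(e)` remains. Since `F` intertwines right translations, this spreads over
`G` (`FieldsRelated.of_rightInvariant`), and subtraction relates the linear fields. For these, being
related is the same as having conjugate flows (`FieldsRelated.flow`, `FieldsRelated.of_flow`). -/

open Set Filter Topology MeasureTheory in
/-- A nonnegative continuous function on `[t₀, t]` that is bounded by a fraction of its own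
running bound vanishes. -/
theorem eq_zero_of_le_mul_bound {d : ℝ → ℝ} {t₀ t c : ℝ} (hd : ContinuousOn d (uIcc t₀ t))
    (hnn : ∀ s, 0 ≤ d s) (hc : c < 1)
    (h : ∀ s ∈ uIcc t₀ t, ∀ B, (∀ r ∈ uIcc t₀ s, d r ≤ B) → d s ≤ c * B) : d t = 0 := by
  obtain ⟨s, hs, hmax⟩ := isCompact_uIcc.exists_isMaxOn nonempty_uIcc hd
  -- At a maximum point `s` of `d`, the bound `B` may be taken to be `d s` itself.
  have h1 : d s ≤ c * d s := h s hs _ fun r hr => hmax (uIcc_subset_uIcc_left hs hr)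
  have h2 := hmax (right_mem_uIcc : t ∈ uIcc t₀ t)
  simp only [mem_ofPred_eq] at h2
  nlinarith [hnn s, hnn t]

namespace AffineControl

open Set Filter Topology MeasureTheory

/-! ### Test functions, charts, and fields at the identity -/

section Fields

variable {E : Type*} [NormedAddCommGroup E] [NormedSpace ℝ E]
  {M : Type*} [TopologicalSpace M] {I : ModelWithCorners ℝ E M}
  {G : Type*} [TopologicalSpace G] [ChartedSpace M G]

theorem IsSmoothField.contMDiff_dirDeriv [IsManifold I ∞ G] {X : ∀ g : G, TangentSpace I g}
    (hX : IsSmoothField I X) {f : G → ℝ} (hf : ContMDiff I 𝓘(ℝ, ℝ) ∞ f) :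
    ContMDiff I 𝓘(ℝ, ℝ) ∞ (fun g => dirDeriv I f g (X g)) :=
  (contMDiff_snd_tangentBundle_modelSpace ℝ 𝓘(ℝ, ℝ)).comp
    ((hf.contMDiff_tangentMap (m := ∞) le_rfl).comp hX)

/-- Linear functionals of a chart extend, near the centre of the chart, to smooth functions. -/
theorem exists_contMDiff_eventuallyEq_extChartAt [FiniteDimensional ℝ E] [T2Space G]
    [IsManifold I ∞ G] (x : G) (l : E →L[ℝ] ℝ) :
    ∃ f : G → ℝ, ContMDiff I 𝓘(ℝ, ℝ) ∞ f ∧ f =ᶠ[𝓝 x] fun y => l (extChartAt I x y) := by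
  obtain ⟨b⟩ : Nonempty (SmoothBumpFunction I x) := inferInstance
  refine ⟨fun y => b y • l (extChartAt I x y), b.contMDiff_smul ?_, ?_⟩
  · exact l.contMDiff.comp_contMDiffOn contMDiffOn_extChartAt
  · filter_upwards [b.eventuallyEq_one] with y hy
    simp [hy]

/-- Smooth real functions separate tangent vectors. -/
theorem eq_of_dirDeriv_eq [FiniteDimensional ℝ E] [T2Space G] [IsManifold I ∞ G] {x : G}
    {v w : TangentSpace I x}
    (h : ∀ f : G → ℝ, ContMDiff I 𝓘(ℝ, ℝ) ∞ f → dirDeriv I f x v = dirDeriv I f x w) :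
    v = w := by
  have : IsManifold I 1 G := IsManifold.of_le (n := ∞) (by simp)
  have hinj := (isInvertible_mfderiv_extChartAt (I := I) (mem_extChartAt_source x)).injective
  apply hinj
  apply (separatingDual_iff_injective.mp
    (inferInstance : SeparatingDual ℝ E))
  ext l
  obtain ⟨f, hf, hfe⟩ := exists_contMDiff_eventuallyEq_extChartAt (I := I) x l
  have hd : MDifferentiableAt I 𝓘(ℝ, E) (extChartAt I x) x :=
    mdifferentiableAt_extChartAt (mem_chart_source M x)
  have key : ∀ v : TangentSpace I x,
      dirDeriv I f x v = l (mfderiv I 𝓘(ℝ, E) (extChartAt I x) x v) := by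
    intro v
    have h1 : mfderiv I 𝓘(ℝ, ℝ) f x = mfderiv I 𝓘(ℝ, ℝ) (l ∘ extChartAt I x) x :=
      hfe.mfderiv_eq
    rw [dirDeriv, h1, mfderiv_comp x l.mdifferentiableAt hd, l.mfderiv_eq]
    rfl
  have := h f hf
  rw [key, key] at this
  exact this

/-- Smooth functions are locally Lipschitz in a chart. -/
theorem exists_lipschitz_extChartAt [I.Boundaryless] [IsManifold I ∞ G] {b : G → ℝ}
    (hb : ContMDiff I 𝓘(ℝ, ℝ) ∞ b) (x : G) :
    ∃ K : ℝ, 0 ≤ K ∧ ∃ V ∈ 𝓝 x, ∀ y ∈ V, ∀ z ∈ V,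
      |b y - b z| ≤ K * ‖extChartAt I x y - extChartAt I x z‖ := by
  have h1 := (contMDiffAt_iff.mp (hb x)).2
  -- Without boundary the chart expression is `C¹` on a full neighbourhood, hence locally Lipschitz.
  rw [I.range_eq_univ, contDiffWithinAt_univ] at h1
  obtain ⟨K, t, ht, hK⟩ := (h1.of_le (m := 1) (by simp)).exists_lipschitzOnWith
  refine ⟨K, K.2, _, inter_mem ((continuousAt_extChartAt (I := I) x).preimage_mem_nhds ht)
    (extChartAt_source_mem_nhds (I := I) x), ?_⟩
  rintro y ⟨hy, hys⟩ z ⟨hz, hzs⟩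
  have := hK.dist_le_mul _ hy _ hz
  rw [Real.dist_eq, dist_eq_norm] at this
  change |b ((extChartAt I x).symm (extChartAt I x y)) -
    b ((extChartAt I x).symm (extChartAt I x z))| ≤ _ at this
  rwa [(extChartAt I x).left_inv hys, (extChartAt I x).left_inv hzs] at this

theorem IsRightInvariant.apply_eq [Group G] [LieGroup I ∞ G] {Z : ∀ g : G, TangentSpace I g}
    (hZ : IsRightInvariant I Z) (g : G) :
    Z g = (mfderiv I I (fun x : G => x * g) 1 (Z 1) : E) := by
  have h : ∀ a b : G, a = b → (Z a : E) = Z b := by rintro _ _ rfl; rfl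
  exact (h _ _ (one_mul g).symm).trans (hZ.map_mul_right g 1).symm

/-- Automorphisms fix the identity, so the flow line through it is constant and has velocity zero.
-/
theorem IsLinearField.apply_one [Group G] [LieGroup I ∞ G] {X : ∀ g : G, TangentSpace I g}
    (hX : IsLinearField I X) : X 1 = 0 := by
  obtain ⟨φ, -, hφ⟩ := hX.exists_flow
  have h := (hφ 1).2
  have hc : (fun t => φ t 1) = fun _ => (1 : G) := funext fun t => map_one (φ t)
  rw [hc] at h
  have h2 := hasMFDerivAt_unique (h 0) (hasMFDerivAt_const (1 : G) (0 : ℝ))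
  have h3 : (1 : ℝ →L[ℝ] ℝ).smulRight (X 1 : E) 1 = (0 : ℝ →L[ℝ] E) 1 :=
    congrArg (fun L : ℝ →L[ℝ] E => L 1) h2
  exact (one_smul ℝ (X 1 : E)).symm.trans h3

end Fields

end AffineControl

namespace AffineControl

open Set Filter Topology MeasureTheory

/-! ### Locally bounded controls -/

theorem IsLInftyLoc.intervalIntegrable {m : ℕ} {u : ℝ → Fin m → ℝ} (hu : IsLInftyLoc u)
    (j : Fin m) (a b : ℝ) : IntervalIntegrable (fun t => u t j) volume a b := by
  rw [intervalIntegrable_iff']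
  have hfin : IsFiniteMeasure (volume.restrict (uIcc a b)) :=
    isFiniteMeasure_restrict.mpr isCompact_uIcc.measure_lt_top.ne
  have h := (hu (uIcc a b) isCompact_uIcc).integrable le_top
  exact (ContinuousLinearMap.proj (R := ℝ) (φ := fun _ : Fin m => ℝ) j).integrable_comp h

theorem IsLInftyLoc.exists_bound {m : ℕ} {u : ℝ → Fin m → ℝ} (hu : IsLInftyLoc u)
    (a b : ℝ) : ∃ R : ℝ, 0 ≤ R ∧ ∀ᵐ t, t ∈ Icc a b → ∀ j, |u t j| ≤ R := by
  have h := hu (Icc a b) isCompact_Icc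
  refine ⟨(eLpNormEssSup u (volume.restrict (Icc a b))).toReal, ENNReal.toReal_nonneg, ?_⟩
  have hlt : eLpNormEssSup u (volume.restrict (Icc a b)) < ⊤ := by
    simpa [eLpNorm_exponent_top] using h.2
  have hae := ae_le_eLpNormEssSup (f := u) (μ := volume.restrict (Icc a b))
  rw [ae_restrict_iff' measurableSet_Icc] at hae
  filter_upwards [hae] with t ht hmem j
  have h1 := ENNReal.toReal_mono hlt.ne (ht hmem)
  rw [toReal_enorm] at h1
  exact (norm_le_pi_norm (u t) j).trans h1

theorem hasDerivAt_comp_of_hasMFDerivAt {E : Type*} [NormedAddCommGroup E] [NormedSpace ℝ E]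
    {M : Type*} [TopologicalSpace M] {I : ModelWithCorners ℝ E M}
    {G : Type*} [TopologicalSpace G] [ChartedSpace M G] {f : G → ℝ} {γ : ℝ → G} {t : ℝ}
    {v : TangentSpace I (γ t)} (hf : MDifferentiableAt I 𝓘(ℝ, ℝ) f (γ t))
    (hγ : HasMFDerivAt 𝓘(ℝ, ℝ) I γ t ((1 : ℝ →L[ℝ] ℝ).smulRight v)) :
    HasDerivAt (f ∘ γ) (dirDeriv I f (γ t) v) t := by
  let A : E →L[ℝ] ℝ := mfderiv I 𝓘(ℝ, ℝ) f (γ t)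
  let B : ℝ →L[ℝ] E := (1 : ℝ →L[ℝ] ℝ).smulRight (v : E)
  have h : HasFDerivAt (f ∘ γ) (A.comp B) t := (hf.hasMFDerivAt.comp t hγ).hasFDerivAt
  have h1 : A.comp B 1 = dirDeriv I f (γ t) v := congrArg A (one_smul ℝ (v : E))
  exact h1 ▸ h.hasDerivAt

/-! ### Carathéodory solutions and their uniqueness -/

namespace AffineSystem

variable {E : Type*} [NormedAddCommGroup E] [NormedSpace ℝ E]
  {M : Type*} [TopologicalSpace M] {I : ModelWithCorners ℝ E M}
  {G : Type*} [TopologicalSpace G] [ChartedSpace M G] [Group G] [LieGroup I ∞ G]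
  {m : ℕ} (S : AffineSystem I G m)

/-- The derivative of `f` along the `k`-th vector field of the system. -/
noncomputable def fieldDeriv (k : Fin (m + 1)) (f : G → ℝ) (g : G) : ℝ :=
  dirDeriv I f g (S.X k g + S.Z k g)

/-- The control enters only through scalar coefficients, so regularity in the state reduces to the
`m + 1` functions `S.fieldDeriv k f`. -/
theorem dirDeriv_field (v : Fin m → ℝ) (f : G → ℝ) (g : G) :
    dirDeriv I f g (S.field v g) =
      S.fieldDeriv 0 f g + ∑ j : Fin m, v j * S.fieldDeriv j.succ f g := by
  unfold field fieldDeriv dirDeriv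
  rw [map_add, map_sum]
  simp only [map_smul]
  rfl

theorem isSmoothField_add (k : Fin (m + 1)) : IsSmoothField I (fun g => S.X k g + S.Z k g) :=
  (S.linear k).smooth.add_section (S.rightInvariant k).smooth

theorem isSmoothField_field (v : Fin m → ℝ) : IsSmoothField I (S.field v) := by
  refine (S.isSmoothField_add 0).add_section (ContMDiff.sum_section fun j _ => ?_)
  exact (S.isSmoothField_add j.succ).const_smul_section

theorem contMDiff_fieldDeriv (k : Fin (m + 1)) {f : G → ℝ} (hf : ContMDiff I 𝓘(ℝ, ℝ) ∞ f) :
    ContMDiff I 𝓘(ℝ, ℝ) ∞ (S.fieldDeriv k f) :=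
  (S.isSmoothField_add k).contMDiff_dirDeriv hf

variable {S} {u : ℝ → Fin m → ℝ} {g : G} {J : Set ℝ} {γ γ₁ γ₂ : ℝ → G}

/-- Integrable controls are multiplied by continuous functions of time. Splitting and subtracting
the integrals in `integral_eq` depends on this integrability. -/
theorem intervalIntegrable_dirDeriv_field (hu : IsLInftyLoc u) {f : G → ℝ}
    (hf : ContMDiff I 𝓘(ℝ, ℝ) ∞ f) {a b : ℝ} (hγ : ContinuousOn γ (uIcc a b)) :
    IntervalIntegrable (fun τ => dirDeriv I f (γ τ) (S.field (u τ) (γ τ))) volume a b := by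
  simp only [dirDeriv_field]
  have hc : ∀ k, ContinuousOn (fun τ => S.fieldDeriv k f (γ τ)) (uIcc a b) := fun k =>
    (S.contMDiff_fieldDeriv k hf).continuous.comp_continuousOn hγ
  refine (hc 0).intervalIntegrable.add ?_
  have h := IntervalIntegrable.sum (μ := volume) (a := a) (b := b) Finset.univ
    (f := fun (j : Fin m) τ => u τ j * S.fieldDeriv j.succ f (γ τ))
    fun j _ => (hu.intervalIntegrable j a b).mul_continuousOn (hc j.succ)
  have hsum : (fun τ => ∑ j : Fin m, u τ j * S.fieldDeriv j.succ f (γ τ)) =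
      ∑ j : Fin m, fun τ => u τ j * S.fieldDeriv j.succ f (γ τ) := by
    ext τ
    simp
  rwa [hsum]

theorem IsSolution.sub_eq_integral (hu : IsLInftyLoc u) (hJ : J.OrdConnected) (h0 : (0 : ℝ) ∈ J)
    (hγ : S.IsSolution u g J γ) {f : G → ℝ} (hf : ContMDiff I 𝓘(ℝ, ℝ) ∞ f) {s t : ℝ}
    (hs : s ∈ J) (ht : t ∈ J) :
    f (γ t) - f (γ s) = ∫ τ in s..t, dirDeriv I f (γ τ) (S.field (u τ) (γ τ)) := by
  have hint : ∀ r ∈ J, IntervalIntegrable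
      (fun τ => dirDeriv I f (γ τ) (S.field (u τ) (γ τ))) volume 0 r := fun r hr =>
    intervalIntegrable_dirDeriv_field hu hf (hγ.continuousOn.mono (hJ.uIcc_subset h0 hr))
  rw [← intervalIntegral.integral_interval_sub_left (hint t ht) (hint s hs),
    ← hγ.integral_eq f hf t ht, ← hγ.integral_eq f hf s hs]
  ring

/-- Near every point there is an injective smooth map to `ℝⁿ` such that the derivatives of its
components along the vector fields of the system are Lipschitz functions of the map. -/
theorem exists_coordinates [FiniteDimensional ℝ E] [I.Boundaryless] [T2Space G]
    (S : AffineSystem I G m) (x : G) :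
    ∃ (n : ℕ) (f : Fin n → G → ℝ), (∀ i, ContMDiff I 𝓘(ℝ, ℝ) ∞ (f i)) ∧
      ∃ K : ℝ, 0 ≤ K ∧ ∃ V ∈ 𝓝 x,
        (∀ y ∈ V, ∀ z ∈ V, (∀ i, f i y = f i z) → y = z) ∧
        ∀ y ∈ V, ∀ z ∈ V, ∀ i k,
          |S.fieldDeriv k (f i) y - S.fieldDeriv k (f i) z| ≤
            K * ‖fun i => f i y - f i z‖ := by
  -- Linear coordinates on `E`; differences of the `f i` near `x` are then the image under `L` of
  -- chart differences, comparable through `‖L.symm‖`.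
  let L : E ≃L[ℝ] (Fin (Module.finrank ℝ E) → ℝ) :=
    ContinuousLinearEquiv.ofFinrankEq (by simp)
  let l : Fin (Module.finrank ℝ E) → E →L[ℝ] ℝ := fun i =>
    (ContinuousLinearMap.proj (R := ℝ) (φ := fun _ : Fin (Module.finrank ℝ E) => ℝ) i).comp
      (L : E →L[ℝ] (Fin (Module.finrank ℝ E) → ℝ))
  choose f hf hfe using fun i => exists_contMDiff_eventuallyEq_extChartAt (I := I) x (l i)
  choose K hK0 V hV hK using fun ik : Fin (Module.finrank ℝ E) × Fin (m + 1) =>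
    exists_lipschitz_extChartAt (S.contMDiff_fieldDeriv ik.2 (hf ik.1)) x
  let W : Set G := (extChartAt I x).source ∩
    {y | ∀ i, f i y = l i (extChartAt I x y)} ∩ ⋂ ik, V ik
  have hW : W ∈ 𝓝 x := inter_mem (inter_mem (extChartAt_source_mem_nhds (I := I) x)
    (eventually_all.mpr hfe)) (iInter_mem.mpr hV)
  have hdiff : ∀ y ∈ W, ∀ z ∈ W,
      (fun i => f i y - f i z) = L (extChartAt I x y - extChartAt I x z) := by
    intro y hy z hz
    ext i
    rw [hy.1.2 i, hz.1.2 i, map_sub]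
    rfl
  have hsum : 0 ≤ ∑ ik, K ik := Finset.sum_nonneg fun ik _ => hK0 ik
  refine ⟨_, f, hf, (∑ ik, K ik) * ‖(L.symm : (Fin (Module.finrank ℝ E) → ℝ) →L[ℝ] E)‖,
    by positivity, W, hW, fun y hy z hz h => ?_, fun y hy z hz i k => ?_⟩
  · have h1 := hdiff y hy z hz
    have h2 : (fun i => f i y - f i z) = 0 := by
      ext i
      simp [h i]
    rw [h2, eq_comm, map_eq_zero_iff L L.injective, sub_eq_zero] at h1
    exact (extChartAt I x).injOn hy.1.1 hz.1.1 h1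
  · have h1 := hK (i, k) y (mem_iInter.mp hy.2 _) z (mem_iInter.mp hz.2 _)
    have h2 : ‖extChartAt I x y - extChartAt I x z‖ ≤
        ‖(L.symm : (Fin (Module.finrank ℝ E) → ℝ) →L[ℝ] E)‖ * ‖fun i => f i y - f i z‖ := by
      rw [hdiff y hy z hz]
      simpa using (L.symm : (Fin (Module.finrank ℝ E) → ℝ) →L[ℝ] E).le_opNorm
        (L (extChartAt I x y - extChartAt I x z))
    calc _ ≤ K (i, k) * ‖extChartAt I x y - extChartAt I x z‖ := h1
      _ ≤ (∑ ik, K ik) * (‖(L.symm : (Fin (Module.finrank ℝ E) → ℝ) →L[ℝ] E)‖ *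
          ‖fun i => f i y - f i z‖) := by
        gcongr
        exact Finset.single_le_sum (f := K) (fun ik _ => hK0 ik) (Finset.mem_univ _)
      _ = _ := by ring

/-- Two Carathéodory solutions that meet at time `t₀` agree near `t₀`. -/
theorem IsSolution.eventually_eq [FiniteDimensional ℝ E] [I.Boundaryless] [T2Space G]
    (hu : IsLInftyLoc u) (hJ : J.OrdConnected) (h0 : (0 : ℝ) ∈ J)
    (h₁ : S.IsSolution u g J γ₁) (h₂ : S.IsSolution u g J γ₂) {t₀ : ℝ} (ht₀ : t₀ ∈ J)
    (heq : γ₁ t₀ = γ₂ t₀) : ∀ᶠ t in 𝓝[J] t₀, γ₁ t = γ₂ t := by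
  obtain ⟨n, f, hf, K, hK0, V, hV, hinj, hK⟩ := S.exists_coordinates (γ₁ t₀)
  obtain ⟨R, hR0, hR⟩ := hu.exists_bound (t₀ - 1) (t₀ + 1)
  have e₁ : ∀ᶠ t in 𝓝[J] t₀, γ₁ t ∈ V := (h₁.continuousOn t₀ ht₀).eventually hV
  have e₂ : ∀ᶠ t in 𝓝[J] t₀, γ₂ t ∈ V := (h₂.continuousOn t₀ ht₀).eventually (heq ▸ hV)
  obtain ⟨ε, hε, hεV⟩ := Metric.mem_nhdsWithin_iff.mp (e₁.and e₂)
  -- A Lipschitz constant for the right-hand side in coordinates: one drift term and `m` terms with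
  -- coefficients at most `R`.
  set C : ℝ := K * (1 + m * R) with hC
  have hC0 : 0 ≤ C := by positivity
  -- `ε` keeps both curves in `V`, `1` keeps time where `R` bounds the control, and the last term
  -- makes `C * δ < 1`.
  set δ : ℝ := min (min ε 1) (1 / (2 * (C + 1))) with hδ
  have hδ0 : 0 < δ := by positivity
  have hCδ : C * δ < 1 := by
    have : δ ≤ 1 / (2 * (C + 1)) := min_le_right _ _
    calc C * δ ≤ C * (1 / (2 * (C + 1))) := by gcongr
      _ < 1 := by
        rw [mul_one_div, div_lt_one (by positivity)]
        linarith
  refine Metric.mem_nhdsWithin_iff.mpr ⟨δ, hδ0, ?_⟩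
  rintro t ⟨htb, htJ⟩
  rw [Metric.mem_ball, Real.dist_eq] at htb
  have hsub : uIcc t₀ t ⊆ J := hJ.uIcc_subset ht₀ htJ
  have hdist : ∀ s ∈ uIcc t₀ t, |s - t₀| ≤ δ := fun s hs =>
    (abs_sub_left_of_mem_uIcc hs).trans htb.le
  have hdist' : ∀ s ∈ uIcc t₀ t, |s - t₀| < δ := fun s hs =>
    (abs_sub_left_of_mem_uIcc hs).trans_lt htb
  have hmem : ∀ s ∈ uIcc t₀ t, γ₁ s ∈ V ∧ γ₂ s ∈ V := fun s hs => by
    refine hεV ⟨?_, hsub hs⟩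
    rw [Metric.mem_ball, Real.dist_eq]
    exact (hdist' s hs).trans_le ((min_le_left _ _).trans (min_le_left _ _))
  have hcont : ContinuousOn (fun s => ‖fun i => f i (γ₁ s) - f i (γ₂ s)‖) (uIcc t₀ t) := by
    refine ContinuousOn.norm (continuousOn_pi.mpr fun i => ?_)
    exact ((hf i).continuous.comp_continuousOn (h₁.continuousOn.mono hsub)).sub
      ((hf i).continuous.comp_continuousOn (h₂.continuousOn.mono hsub))
  have hz : ‖fun i => f i (γ₁ t) - f i (γ₂ t)‖ = 0 := by
    refine eq_zero_of_le_mul_bound hcont (fun _ => norm_nonneg _) hCδ fun s hs B hB => ?_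
    have hB0 : 0 ≤ B := (norm_nonneg _).trans (hB s right_mem_uIcc)
    have hss : uIcc t₀ s ⊆ uIcc t₀ t := uIcc_subset_uIcc_left hs
    refine (pi_norm_le_iff_of_nonneg (by positivity)).mpr fun i => ?_
    have i₁ := h₁.sub_eq_integral hu hJ h0 (hf i) ht₀ (hsub hs)
    have i₂ := h₂.sub_eq_integral hu hJ h0 (hf i) ht₀ (hsub hs)
    have hint : f i (γ₁ s) - f i (γ₂ s) = ∫ τ in t₀..s,
        (dirDeriv I (f i) (γ₁ τ) (S.field (u τ) (γ₁ τ)) -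
          dirDeriv I (f i) (γ₂ τ) (S.field (u τ) (γ₂ τ))) := by
      rw [intervalIntegral.integral_sub
        (intervalIntegrable_dirDeriv_field hu (hf i)
          (h₁.continuousOn.mono (hss.trans hsub)))
        (intervalIntegrable_dirDeriv_field hu (hf i)
          (h₂.continuousOn.mono (hss.trans hsub))), ← i₁, ← i₂, heq]
      ring
    rw [hint]
    have hbound : ∀ᵐ τ, τ ∈ uIoc t₀ s →
        ‖dirDeriv I (f i) (γ₁ τ) (S.field (u τ) (γ₁ τ)) -
          dirDeriv I (f i) (γ₂ τ) (S.field (u τ) (γ₂ τ))‖ ≤ C * B := by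
      filter_upwards [hR] with τ hτR hτ
      have hτs := uIoc_subset_uIcc hτ
      have hτt := hss hτs
      have hτ1 : τ ∈ Icc (t₀ - 1) (t₀ + 1) := by
        have := abs_le.mp ((hdist τ hτt).trans ((min_le_left _ _).trans (min_le_right _ _)))
        exact ⟨by linarith, by linarith⟩
      have hk : ∀ k, |S.fieldDeriv k (f i) (γ₁ τ) - S.fieldDeriv k (f i) (γ₂ τ)| ≤ K * B :=
        fun k => (hK _ (hmem τ hτt).1 _ (hmem τ hτt).2 i k).trans (by gcongr; exact hB τ hτs)
      rw [dirDeriv_field, dirDeriv_field, add_sub_add_comm, ← Finset.sum_sub_distrib]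
      calc _ ≤ K * B + ∑ _j : Fin m, R * (K * B) := by
            refine (norm_add_le _ _).trans (add_le_add (hk 0) ?_)
            refine norm_sum_le_of_le _ fun j _ => ?_
            rw [← mul_sub, norm_mul]
            exact mul_le_mul (hτR hτ1 j) (hk _) (norm_nonneg _) hR0
        _ = C * B := by
            rw [Finset.sum_const, Finset.card_univ, Fintype.card_fin, nsmul_eq_mul, hC]
            ring
    calc _ ≤ C * B * |s - t₀| := intervalIntegral.norm_integral_le_of_norm_le_const_ae hbound
      _ ≤ C * B * δ := by gcongr; exact hdist s hs
      _ = C * δ * B := by ring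
  rw [norm_eq_zero] at hz
  exact hinj _ (hmem t right_mem_uIcc).1 _ (hmem t right_mem_uIcc).2 fun i =>
    sub_eq_zero.mp (congrFun hz i)

/-- Uniqueness of Carathéodory solutions. -/
theorem IsSolution.eqOn [FiniteDimensional ℝ E] [I.Boundaryless] [T2Space G]
    (hu : IsLInftyLoc u) (hJ : J.OrdConnected) (h0 : (0 : ℝ) ∈ J)
    (h₁ : S.IsSolution u g J γ₁) (h₂ : S.IsSolution u g J γ₂) : EqOn γ₁ γ₂ J := by
  have : PreconnectedSpace J := isPreconnected_iff_preconnectedSpace.mp hJ.isPreconnected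
  -- Closed because `G` is Hausdorff, open by local uniqueness; `J` is connected and contains `0`.
  have hclopen : IsClopen {t : J | γ₁ t = γ₂ t} := by
    refine ⟨isClosed_eq (continuousOn_iff_continuous_domRestrict.mp h₁.continuousOn)
      (continuousOn_iff_continuous_domRestrict.mp h₂.continuousOn),
      isOpen_iff_mem_nhds.mpr fun t ht => ?_⟩
    have := h₁.eventually_eq hu hJ h0 h₂ t.2 ht
    rw [← map_nhds_subtype_val] at this
    exact this
  have huniv := hclopen.eq_univ ⟨⟨0, h0⟩, h₁.initial.trans h₂.initial.symm⟩
  intro t ht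
  exact (huniv ▸ mem_univ (⟨t, ht⟩ : J) : (⟨t, ht⟩ : J) ∈ {t : J | γ₁ t = γ₂ t})

/-- An integral curve of the field with a constant control is a solution. -/
theorem isSolution_of_isMIntegralCurveOn {v : Fin m → ℝ} (hJ : J.OrdConnected)
    (h0 : (0 : ℝ) ∈ J) {s : Set ℝ} (hs : IsOpen s) (hJs : J ⊆ s)
    (hγ : IsMIntegralCurveOn (I := I) γ (S.field v) s) (hg : γ 0 = g) :
    S.IsSolution (fun _ => v) g J γ := by
  have hder : ∀ f : G → ℝ, ContMDiff I 𝓘(ℝ, ℝ) ∞ f → ∀ t ∈ J,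
      HasDerivAt (f ∘ γ) (dirDeriv I f (γ t) (S.field v (γ t))) t := by
    intro f hf t ht
    have h1 := (hγ t (hJs ht)).hasMFDerivAt (hs.mem_nhds (hJs ht))
    exact hasDerivAt_comp_of_hasMFDerivAt (hf.mdifferentiableAt (by simp)) h1
  refine ⟨hg, hγ.continuousOn.mono hJs, fun f hf t ht => ?_⟩
  have hsub := hJ.uIcc_subset h0 ht
  have hcont : ContinuousOn (fun τ => dirDeriv I f (γ τ) (S.field v (γ τ))) (uIcc 0 t) :=
    ((S.isSmoothField_field v).contMDiff_dirDeriv hf).continuous.comp_continuousOn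
      (hγ.continuousOn.mono (hsub.trans hJs))
  rw [intervalIntegral.integral_eq_sub_of_hasDerivAt (f := f ∘ γ)
    (fun τ hτ => hder f hf τ (hsub hτ)) hcont.intervalIntegrable, ← hg]
  rfl

end AffineSystem

end AffineControl

namespace AffineControl

open Set Filter Topology MeasureTheory

/-! ### `F`-related vector fields and their flows -/

section Related

variable {E : Type*} [NormedAddCommGroup E] [NormedSpace ℝ E]
  {M : Type*} [TopologicalSpace M] {I : ModelWithCorners ℝ E M}
  {G : Type*} [TopologicalSpace G] [ChartedSpace M G]
  {E' : Type*} [NormedAddCommGroup E'] [NormedSpace ℝ E']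
  {M' : Type*} [TopologicalSpace M'] {I' : ModelWithCorners ℝ E' M'}
  {H : Type*} [TopologicalSpace H] [ChartedSpace M' H]

variable (I I') in
/-- The vector fields `X` and `Y` are `F`-related. -/
def FieldsRelated (F : G → H) (X : ∀ g : G, TangentSpace I g) (Y : ∀ h : H, TangentSpace I' h) :
    Prop :=
  ∀ g, mfderiv I I' F g (X g) = Y (F g)

theorem tangentBundle_mk_eq_iff {x y : G} {v : TangentSpace I x} {w : TangentSpace I y} :
    (⟨x, v⟩ : TangentBundle I G) = ⟨y, w⟩ ↔ x = y ∧ (v : E) = w := by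
  constructor
  · intro h
    cases h
    exact ⟨rfl, rfl⟩
  · rintro ⟨rfl, h⟩
    exact congrArg (Bundle.TotalSpace.mk (F := E) (E := TangentSpace I) x) h

theorem dirDeriv_comp {F : G → H} {f : H → ℝ} {g : G} (hf : MDifferentiableAt I' 𝓘(ℝ, ℝ) f (F g))
    (hF : MDifferentiableAt I I' F g) (v : TangentSpace I g) :
    dirDeriv I (f ∘ F) g v = dirDeriv I' f (F g) (mfderiv I I' F g v) := by
  unfold dirDeriv
  rw [mfderiv_comp g hf hF]
  rfl

theorem FieldsRelated.comp_isMIntegralCurve {F : G → H} {X : ∀ g : G, TangentSpace I g}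
    {Y : ∀ h : H, TangentSpace I' h} (h : FieldsRelated I I' F X Y)
    (hF : MDifferentiable I I' F) {γ : ℝ → G} (hγ : IsMIntegralCurve (I := I) γ X) :
    IsMIntegralCurve (I := I') (F ∘ γ) Y := by
  intro t
  let A : E →L[ℝ] E' := mfderiv I I' F (γ t)
  have e : ∀ (x : E) (y : E'), A x = y →
      A.comp ((1 : ℝ →L[ℝ] ℝ).smulRight x) = (1 : ℝ →L[ℝ] ℝ).smulRight y := by
    rintro x _ rfl
    ext
    simp
  exact ((hF (γ t)).hasMFDerivAt.comp t (hγ t)).congr_mfderiv (e _ _ (h (γ t)))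

/-- A smooth map that conjugates flows relates the generating fields. -/
theorem FieldsRelated.of_flow {F : G → H} {X : ∀ g : G, TangentSpace I g}
    {Y : ∀ h : H, TangentSpace I' h} (hF : MDifferentiable I I' F)
    {φ : ℝ → G → G} {ψ : ℝ → H → H} (hφ : IsFlow I X φ) (hψ : IsFlow I' Y ψ)
    (h : ∀ t, F ∘ φ t = ψ t ∘ F) : FieldsRelated I I' F X Y := by
  intro g
  obtain ⟨hφ0, hφ1⟩ := hφ g
  obtain ⟨hψ0, hψ1⟩ := hψ (F g)
  have hcurve : (fun t => ψ t (F g)) = F ∘ fun t => φ t g := funext fun t => (congrFun (h t) g).symm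
  rw [hcurve] at hψ1
  have h1 := hasMFDerivAt_unique ((hF (φ 0 g)).hasMFDerivAt.comp 0 (hφ1 0)) (hψ1 0)
  have h2 : mfderiv I I' F (φ 0 g) ((1 : ℝ) • X (φ 0 g)) = ((1 : ℝ) • Y (F (φ 0 g)) : E') :=
    congrArg (fun L : ℝ →L[ℝ] E' => L 1) h1
  rw [one_smul, one_smul, hφ0] at h2
  exact h2

/-- Flows of related smooth fields are conjugate. -/
theorem FieldsRelated.flow [I'.Boundaryless] [T2Space H] [IsManifold I' ∞ H]
    {F : G → H} {X : ∀ g : G, TangentSpace I g}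
    {Y : ∀ h : H, TangentSpace I' h} (h : FieldsRelated I I' F X Y) (hY : IsSmoothField I' Y)
    (hF : MDifferentiable I I' F) {φ : ℝ → G → G} {ψ : ℝ → H → H}
    (hφ : IsFlow I X φ) (hψ : IsFlow I' Y ψ) (t : ℝ) : F ∘ φ t = ψ t ∘ F := by
  have : IsManifold I' 1 H := IsManifold.of_le (n := ∞) (by simp)
  ext g
  refine congrFun (isMIntegralCurve_Ioo_eq_of_contMDiff_boundaryless (t₀ := 0)
    (hY.of_le (by simp)) (h.comp_isMIntegralCurve hF (hφ g).2) (hψ (F g)).2 ?_) t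
  simp [(hφ g).1, (hψ (F g)).1]

theorem FieldsRelated.add {F : G → H} {X₁ X₂ : ∀ g : G, TangentSpace I g}
    {Y₁ Y₂ : ∀ h : H, TangentSpace I' h} (h₁ : FieldsRelated I I' F X₁ Y₁)
    (h₂ : FieldsRelated I I' F X₂ Y₂) :
    FieldsRelated I I' F (fun g => X₁ g + X₂ g) (fun h => Y₁ h + Y₂ h) := fun g => by
  rw [map_add, h₁ g, h₂ g]

/-- Right invariant fields are related by a homomorphism as soon as they are at the identity. -/
theorem FieldsRelated.of_rightInvariant [Group G] [LieGroup I ∞ G] [Group H] [LieGroup I' ∞ H]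
    (F : ContMDiffMonoidMorphism I I' ∞ G H) {Z : ∀ g : G, TangentSpace I g}
    {W : ∀ h : H, TangentSpace I' h} (hZ : IsRightInvariant I Z) (hW : IsRightInvariant I' W)
    (h : (mfderiv I I' F 1 (Z 1) : E') = W 1) : FieldsRelated I I' F Z W := by
  intro g
  have hF : MDifferentiable I I' F := F.contMDiff_toFun.mdifferentiable (by simp)
  have hRg : MDifferentiable I I (fun x : G => x * g) :=
    (contMDiff_mul_right (I := I) (n := ∞) (a := g)).mdifferentiable (by simp)
  have hRFg : MDifferentiable I' I' (fun y : H => y * F g) :=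
    (contMDiff_mul_right (I := I') (n := ∞) (a := F g)).mdifferentiable (by simp)
  -- Differentiating this identity at `1` carries the relation from the identity to `g`.
  have hcomm : F ∘ (fun x : G => x * g) = (fun y : H => y * F g) ∘ F :=
    funext fun x => map_mul F x g
  -- `1 * g` and `g` are only propositionally equal, so derivatives are transported between the
  -- fibres, all of which are the model space.
  have e : ∀ (a b : G), a = b → ∀ v : E,
      (mfderiv I I' F a : E →L[ℝ] E') v = (mfderiv I I' F b : E →L[ℝ] E') v := by
    rintro _ _ rfl v
    rfl
  have e' : ∀ (a b : H), a = b → ∀ v : E',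
      (mfderiv I' I' (fun y : H => y * F g) a : E' →L[ℝ] E') v =
        (mfderiv I' I' (fun y : H => y * F g) b : E' →L[ℝ] E') v := by
    rintro _ _ rfl v
    rfl
  have h1 : (mfderiv I I' F (1 * g) : E →L[ℝ] E').comp
      (mfderiv I I (fun x : G => x * g) 1 : E →L[ℝ] E) =
      (mfderiv I' I' (fun y : H => y * F g) (F 1) : E' →L[ℝ] E').comp
        (mfderiv I I' F 1 : E →L[ℝ] E') := by
    have h2 := mfderiv_comp (1 : G) (hF (1 * g)) (hRg 1)
    have h3 := mfderiv_comp (1 : G) (hRFg (F 1)) (hF 1)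
    rw [hcomm] at h2
    exact h2.symm.trans h3
  have h4 := congrArg (fun L : E →L[ℝ] E' => L (Z 1 : E)) h1
  refine (congrArg (mfderiv I I' F g : E →L[ℝ] E') (hZ.apply_eq g)).trans ?_
  refine (e _ _ (one_mul g).symm _).trans (h4.trans ?_)
  refine (e' _ _ (map_one F) _).trans ?_
  refine Eq.trans ?_ (hW.apply_eq (F g)).symm
  exact congrArg (mfderiv I' I' (fun y : H => y * F g) 1 : E' →L[ℝ] E') h

end Related

/-! ### Conjugation of solutions versus related fields -/

section Conjugation

variable {E : Type*} [NormedAddCommGroup E] [NormedSpace ℝ E]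
  {M : Type*} [TopologicalSpace M] {I : ModelWithCorners ℝ E M}
  {G : Type*} [TopologicalSpace G] [ChartedSpace M G] [Group G] [LieGroup I ∞ G]
  {E' : Type*} [NormedAddCommGroup E'] [NormedSpace ℝ E'] [FiniteDimensional ℝ E']
  {M' : Type*} [TopologicalSpace M'] {I' : ModelWithCorners ℝ E' M'}
  {H : Type*} [TopologicalSpace H] [ChartedSpace M' H] [Group H] [LieGroup I' ∞ H]
  [T2Space H] {m : ℕ} {S : AffineSystem I G m} {S' : AffineSystem I' H m}
  {U : Set (ℝ → Fin m → ℝ)} {F : G → H}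

/-- Maps relating the fields of two systems conjugate their solutions. -/
theorem ConjugatesSolutions.of_fieldsRelated [I'.Boundaryless] (hU : ∀ u ∈ U, IsLInftyLoc u)
    (hF : ContMDiff I I' ∞ F)
    (h : ∀ k, FieldsRelated I I' F (fun g => S.X k g + S.Z k g)
      (fun h => S'.X k h + S'.Z k h)) : ConjugatesSolutions U S S' F := by
  intro u hu g J hJ h0 γ hγ
  have hsol : S'.IsSolution u (F g) J (F ∘ γ) := by
    refine ⟨congrArg F hγ.initial, hF.continuous.comp_continuousOn hγ.continuousOn,
      fun f hf t ht => ?_⟩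
    refine (hγ.integral_eq (f ∘ F) (hf.comp hF) t ht).trans ?_
    refine intervalIntegral.integral_congr fun τ _ => ?_
    have hk : ∀ k, S.fieldDeriv k (f ∘ F) (γ τ) = S'.fieldDeriv k f (F (γ τ)) := fun k =>
      (dirDeriv_comp (hf.mdifferentiableAt (by simp)) (hF.mdifferentiableAt (by simp)) _).trans
        (congrArg (dirDeriv I' f (F (γ τ))) (h k (γ τ)))
    simp only [AffineSystem.dirDeriv_field, hk, Function.comp_apply]
  exact ⟨⟨_, hsol⟩, fun θ hθ t ht => hsol.eqOn (hU u hu) hJ h0 hθ ht⟩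

/-- A map conjugating the solutions of two systems relates their fields for constant
admissible controls. -/
theorem ConjugatesSolutions.fieldsRelated [FiniteDimensional ℝ E] [I.Boundaryless]
    (hc : ConjugatesSolutions U S S' F)
    (hF : ContMDiff I I' ∞ F) {v : Fin m → ℝ} (hv : (fun _ => v) ∈ U) :
    FieldsRelated I I' F (S.field v) (S'.field v) := by
  intro g
  have : IsManifold I 1 G := IsManifold.of_le (n := ∞) (by simp)
  have hcE : CompleteSpace E := FiniteDimensional.complete ℝ E
  obtain ⟨γ, hγ0, hγ⟩ := exists_isMIntegralCurveAt_of_contMDiffAt_boundaryless (t₀ := 0)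
    (((S.isSmoothField_field v) g).of_le (m := 1) (by simp))
  obtain ⟨ε, hε, hγε⟩ := isMIntegralCurveAt_iff'.mp hγ
  have hJ : (Metric.ball (0 : ℝ) ε).OrdConnected := (convex_ball (0 : ℝ) ε).ordConnected
  have h0 : (0 : ℝ) ∈ Metric.ball (0 : ℝ) ε := Metric.mem_ball_self hε
  obtain ⟨⟨θ, hθ⟩, heq⟩ := hc _ hv g _ hJ h0 γ
    (AffineSystem.isSolution_of_isMIntegralCurveOn hJ h0 Metric.isOpen_ball subset_rfl hγε hγ0)
  have hθe : EqOn θ (F ∘ γ) (Metric.ball 0 ε) := fun t ht => (heq θ hθ t ht).symm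
  refine eq_of_dirDeriv_eq fun f hf => ?_
  have hd₁ := hasDerivAt_comp_of_hasMFDerivAt ((hf.comp hF).mdifferentiableAt (by simp))
    hγ.hasMFDerivAt
  -- With a constant control the integrand is continuous, so the integral equation for `θ` can be
  -- differentiated at `0`.
  have hcont : ContinuousOn (fun τ => dirDeriv I' f (θ τ) (S'.field v (θ τ)))
      (Metric.ball 0 ε) :=
    ((S'.isSmoothField_field v).contMDiff_dirDeriv hf).continuous.comp_continuousOn hθ.continuousOn
  have hd₂ : HasDerivAt (fun t => ∫ τ in (0 : ℝ)..t, dirDeriv I' f (θ τ) (S'.field v (θ τ)))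
      (dirDeriv I' f (θ 0) (S'.field v (θ 0))) 0 :=
    intervalIntegral.integral_hasDerivAt_right (by simp)
      (hcont.stronglyMeasurableAtFilter Metric.isOpen_ball 0 h0)
      (hcont.continuousAt (Metric.isOpen_ball.mem_nhds h0))
  have hd₃ := hd₂.const_add (f (F g))
  have hee : (f ∘ F) ∘ γ =ᶠ[𝓝 0]
      fun t => f (F g) + ∫ τ in (0 : ℝ)..t, dirDeriv I' f (θ τ) (S'.field v (θ τ)) := by
    filter_upwards [Metric.ball_mem_nhds (0 : ℝ) hε] with t ht
    rw [← hθ.integral_eq f hf t ht, hθe ht]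
    simp
  have h1 := hd₁.unique (hd₃.congr_of_eventuallyEq hee)
  rw [dirDeriv_comp (hf.mdifferentiableAt (by simp)) (hF.mdifferentiableAt (by simp)),
    hθ.initial, hγ0] at h1
  exact h1

end Conjugation

end AffineControl

/-! ### The equivalence -/

open AffineControl in
theorem theorem4p2
    {E : Type*} [NormedAddCommGroup E] [NormedSpace ℝ E] [FiniteDimensional ℝ E]
    {M : Type*} [TopologicalSpace M] (I : ModelWithCorners ℝ E M) [I.Boundaryless]
    {G : Type*} [TopologicalSpace G] [ChartedSpace M G] [Group G] [LieGroup I ∞ G]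
    [T2Space G] [ConnectedSpace G]
    {E' : Type*} [NormedAddCommGroup E'] [NormedSpace ℝ E'] [FiniteDimensional ℝ E']
    {M' : Type*} [TopologicalSpace M'] (I' : ModelWithCorners ℝ E' M') [I'.Boundaryless]
    {H : Type*} [TopologicalSpace H] [ChartedSpace M' H] [Group H] [LieGroup I' ∞ H]
    [T2Space H] [ConnectedSpace H]
    (m : ℕ)
    -- the two affine systems, with vector fields `S.X i`, `S.Z i` and `S'.X i`, `S'.Z i`
    (S : AffineControl.AffineSystem I G m) (S' : AffineControl.AffineSystem I' H m)
    -- the flows of the linear vector fields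
    (φ : Fin (m + 1) → ℝ → G → G) (hφ : ∀ i, AffineControl.IsFlow I (S.X i) (φ i))
    (ψ : Fin (m + 1) → ℝ → H → H) (hψ : ∀ i, AffineControl.IsFlow I' (S'.X i) (ψ i))
    -- the admissible controls, among them the constant controls `0` and `e_j`
    (U : Set (ℝ → Fin m → ℝ)) (hU : ∀ u ∈ U, AffineControl.IsLInftyLoc u)
    (hU_zero : (fun _ => 0) ∈ U) (hU_single : ∀ j : Fin m, (fun _ => Pi.single j 1) ∈ U)
    (F : ContMDiffMonoidMorphism I I' ∞ G H) :
    AffineControl.ConjugatesSolutions U S S' F ↔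
      (∀ (i : Fin (m + 1)) (t : ℝ), ⇑F ∘ φ i t = ψ i t ∘ ⇑F) ∧
      -- equality in the tangent bundle of `H`, i.e. `dF_e (Z_j(e)) = W_j(e)` in `T_e H`
      (∀ j : Fin (m + 1),
        tangentMap I I' F (⟨1, S.Z j 1⟩ : TangentBundle I G) = ⟨1, S'.Z j 1⟩) := by
  have hF : ContMDiff I I' ∞ F := F.contMDiff_toFun
  have hFd : MDifferentiable I I' F := hF.mdifferentiable (by simp)
  have hval : ∀ {Y : ∀ h : H, TangentSpace I' h} (a b : H), a = b → (Y a : E') = Y b := by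
    rintro Y _ _ rfl
    rfl
  constructor
  · intro hc
    have hV : ∀ k, FieldsRelated I I' F (fun g => S.X k g + S.Z k g)
        (fun h => S'.X k h + S'.Z k h) := by
      have h0 : FieldsRelated I I' F (fun g => S.X 0 g + S.Z 0 g)
          (fun h => S'.X 0 h + S'.Z 0 h) := by
        intro g
        simpa [AffineSystem.field] using hc.fieldsRelated hF hU_zero g
      refine Fin.cases h0 fun j g => ?_
      have h1 := hc.fieldsRelated hF (hU_single j) g
      simp only [AffineSystem.field, Pi.single_apply, ite_smul, one_smul, zero_smul,
        Finset.sum_ite_eq', Finset.mem_univ, if_true] at h1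
      -- The field at control `e_j` is the drift plus the `j`-th controlled field; the drift
      -- relation from control `0` cancels.
      rw [map_add, h0 g] at h1
      exact add_left_cancel h1
    have hZ : ∀ j, (mfderiv I I' F 1 (S.Z j 1) : E') = S'.Z j 1 := by
      intro j
      have h1 := hV j 1
      have hX : S.X j 1 + S.Z j 1 = S.Z j 1 := by rw [(S.linear j).apply_one, zero_add]
      have hY : S'.X j 1 + S'.Z j 1 = S'.Z j 1 := by rw [(S'.linear j).apply_one, zero_add]
      simp only [hX] at h1
      exact h1.trans ((hval (Y := fun h => S'.X j h + S'.Z j h) _ _ (map_one F)).trans hY)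
    refine ⟨fun i t => ?_, fun j => tangentBundle_mk_eq_iff.mpr ⟨map_one F, hZ j⟩⟩
    have hZi := FieldsRelated.of_rightInvariant F (S.rightInvariant i) (S'.rightInvariant i) (hZ i)
    have hXi : FieldsRelated I I' F (S.X i) (S'.X i) := by
      intro g
      have h1 := hV i g
      simp only [map_add, hZi g] at h1
      exact add_right_cancel h1
    exact hXi.flow (S'.linear i).smooth hFd (hφ i) (hψ i) t
  · rintro ⟨hflow, hZ⟩
    refine ConjugatesSolutions.of_fieldsRelated hU hF fun k => ?_
    exact (FieldsRelated.of_flow hFd (hφ k) (hψ k) (hflow k)).add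
      (.of_rightInvariant F (S.rightInvariant k) (S'.rightInvariant k)
        (tangentBundle_mk_eq_iff.mp (hZ k)).2)
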